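/- Let $p\ge 1$ and $s\ge 1$ be integers and let $E$ be the set of the $n=\binom p2$ edges of the complete graph on $p$ vertices. An $s$-star is a set of $s$ edges that have a common vertex; stars are disjoint if they share no edge. Let $N(p,s)$ be the maximal number of pairwise disjoint $s$-stars. Then $$N(p,s)\ \ge\ \frac{p(p-1-s)}{2s}.$$ For $\mu>0$ and $S\subseteq E$ let $x\in\mathbb R^E$ be the signal with $x_i=\mu$ for $i\in S$ and $x_i=0$ for $i\notin S$. An adaptive procedure collects measurements $Y_j=x_{A_j}+\Gamma_j^{-1/2}W_j$, $j=1,2,\dots$, where the coordinate $A_j\in E$ and the precision $\Gamma_j\ge 0$ are (possibly randomized) measurable functions of the past $\{Y_i,A_i,\Gamma_i\}_{i<j}$, the $W_j$ are i.i.d. standard normal with $W_j$ independent of $\{A_i,\Gamma_i\}_{i\le j}$, and $\Gamma_j=0$ means that no measurement is made; at the end it outputs an estimate $\hat S\subseteq E$, a measurable function of $\{Y_j,A_j,\Gamma_j\}_{j\ge1}$. Let $\mathbb E_S$ be the expectation when the support is $S$. Let $1\le k<N(p,s)$, and let $\mathcal C$ be the class of all unions of $k$, or of $k-1$, pairwise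 disjoint $s$-stars. Let $m>0$ and $\varepsilon\in(0,1)$, and consider an adaptive procedure with $$\mathbb E_S\Big(\sum_j\Gamma_j\Big)\le m\quad\text{and}\quad \mathbb E_S\big(|\hat S\,\triangle\, S|\big)\le\varepsilon\qquad\text{for all }S\in\mathcal C.$$ Then necessarily $$\mu\ \ge\ \sqrt{\frac{2\,(N(p,s)-k)}{m}\left(\log k+\log\frac{N(p,s)-k}{N(p,s)+1}+\log\frac{s}{8\varepsilon}\right)},$$ where the right-hand side is read as $0$ if the quantity under the root is negative. -/

import Mathlib

open MeasureTheory ProbabilityTheory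
open scoped NNReal ENNReal

namespace AdaptiveSensing

/-! ### The sensing model -/

section Model

variable {ι : Type*} [Fintype ι] [DecidableEq ι] [MeasurableSpace ι] [MeasurableSingletonClass ι]

/-- A record `((A, Γ), Y)` of one measurement: the measured coordinate `A`, the precision `Γ`, and
the outcome `Y`. -/
abbrev Record (ι : Type*) : Type _ := (ι × ℝ≥0) × ℝ

/-- The signal with support `S` and magnitude `μ`. -/
def signal (μ : ℝ) (S : Finset ι) (i : ι) : ℝ := if i ∈ S then μ else 0

/-- The law of an outcome `Y = x_A + Γ^{-1/2} W`, `W ∼ N(0,1)`, given `(A, Γ)`, that is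
`N(x_A, Γ⁻¹)`. Precision `Γ = 0` means that no measurement is made: the outcome is the constant `0`,
which carries no information. -/
noncomputable def outcomeKernel (μ : ℝ) (S : Finset ι) : Kernel (ι × ℝ≥0) ℝ where
  toFun q := if q.2 = 0 then Measure.dirac 0 else gaussianReal (signal μ S q.1) q.2⁻¹
  measurable' := by
    refine Measurable.ite (measurable_snd (measurableSet_singleton 0)) measurable_const ?_
    have h : Measurable (fun q : ι × ℝ≥0 => (signal μ S q.1, q.2⁻¹)) :=
      ((measurable_of_finite (signal μ S)).comp measurable_fst).prodMk measurable_snd.inv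
    exact measurable_gaussianReal.comp h

instance (μ : ℝ) (S : Finset ι) : IsMarkovKernel (outcomeKernel μ S) where
  isProbabilityMeasure q := by
    change IsProbabilityMeasure
      (if q.2 = 0 then Measure.dirac 0 else gaussianReal (signal μ S q.1) q.2⁻¹)
    split_ifs <;> infer_instance

/-- An adaptive sensing and estimation procedure. The first pair `(A, Γ)` is drawn from `first`;
given all records up to time `j`, the pair `(A, Γ)` at time `j + 1` is drawn from `next j`, so that
it is a possibly randomized function of the past that does not depend on the unknown support.
The estimator is a measurable function of the whole sequence of records. -/
structure Procedure (ι : Type*) [MeasurableSpace ι] where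
  first : Measure (ι × ℝ≥0)
  first_prob : IsProbabilityMeasure first
  next : (j : ℕ) → Kernel ((i : Finset.Iic j) → Record ι) (ι × ℝ≥0)
  next_markov : ∀ j, IsMarkovKernel (next j)
  estimator : (ℕ → Record ι) → Finset ι
  measurable_estimator : ∀ i, MeasurableSet {ω | i ∈ estimator ω}

attribute [instance] Procedure.first_prob Procedure.next_markov

namespace Procedure

/-- The joint law of all the records when the support is `S` and the magnitude is `μ`. -/
noncomputable def law (π : Procedure ι) (μ : ℝ) (S : Finset ι) : Measure (ℕ → Record ι) :=
  Kernel.trajMeasure (X := fun _ => Record ι) (π.first ⊗ₘ outcomeKernel μ S)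
    (fun j => π.next j ⊗ₖ (outcomeKernel μ S).prodMkLeft ((i : Finset.Iic j) → Record ι))

/-- The expected total precision that is used when the support is `S`. -/
noncomputable def expectedPrecision (π : Procedure ι) (μ : ℝ) (S : Finset ι) : ℝ≥0∞ :=
  ∫⁻ ω, ∑' j, ((ω j).1.2 : ℝ≥0∞) ∂(π.law μ S)

/-- The expected Hamming distance of the estimator to the support `S`. -/
noncomputable def expectedError (π : Procedure ι) (μ : ℝ) (S : Finset ι) : ℝ≥0∞ :=
  ∫⁻ ω, ((symmDiff (π.estimator ω) S).card : ℝ≥0∞) ∂(π.law μ S)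

end Procedure

end Model

/-! ### Stars -/

/-- The edges of the complete graph on `p` vertices; they index the coordinates of the signal. -/
abbrev Edge (p : ℕ) : Type := (⊤ : SimpleGraph (Fin p)).edgeSet

instance (p : ℕ) : MeasurableSpace (Edge p) := ⊤

/-- `T` is a star of size `s`: `s` edges with a common vertex. -/
def IsStar {p : ℕ} (s : ℕ) (T : Finset (Edge p)) : Prop :=
  T.card = s ∧ ∃ v : Fin p, ∀ e ∈ T, v ∈ (e : Sym2 (Fin p))

/-- `T` lists `k` stars of size `s`, no two of which have an edge in common. -/
def AreDisjointStars {p k : ℕ} (s : ℕ) (T : Fin k → Finset (Edge p)) : Prop :=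
  (∀ i, IsStar s (T i)) ∧ Pairwise fun i j => Disjoint (T i) (T j)

/-- `N(p, s)`: the maximal number of disjoint stars of size `s` in the complete graph on `p`
vertices (for `s ≥ 1`, when these numbers are bounded). -/
noncomputable def maxDisjointStars (p s : ℕ) : ℕ :=
  sSup {N : ℕ | ∃ T : Fin N → Finset (Edge p), AreDisjointStars s T}

/-- The class of all unions of `k` disjoint stars of size `s`. -/
def starUnions (p s k : ℕ) : Set (Finset (Edge p)) :=
  {S | ∃ T : Fin k → Finset (Edge p), AreDisjointStars s T ∧ S = Finset.univ.biUnion T}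

end AdaptiveSensing

namespace AdaptiveSensing

open InformationTheory Function

/-! For the star count, a maximum family leaves fewer than `s` uncovered edges at each vertex, since
`s` of them would form another star. So at most `p * s / 2` edges are uncovered. For the signal
bound, fix a maximum family `T` of `N` disjoint stars and let `S` be a union of `k - 1` of them.
Adding a further star `T i` changes the law of the records by a divergence of at most `μ ^ 2 / 2`
times the precision spent on `T i` under `S`: the sensing rule does not know the support, so only
outcomes measured on `T i` carry information (`klDiv_lawUpTo_le`). The stars are disjoint, so these
precisions sum to at most `m`. By Bretagnolle-Huber, each edge of `T i` then incurs a false positive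
under `S` or a false negative under `S ∪ T i`, with probabilities bounded below in sum
(`card_mul_exp_neg_le`). Jensen's inequality over the unused stars gives a lower bound on the total
error, and averaging over all choices of `k - 1` stars compares it with `ε` (`le_of_sum_errors_le`).
Only supports of `k - 1` stars need the precision budget. -/

/-! ### Kullback-Leibler divergences -/

/-- The Kullback-Leibler divergence of two composition-products with the same first factor is the
average of the divergences of the kernels, if one kernel has a jointly measurable density with
respect to the other one. -/
theorem klDiv_compProd_withDensity {X Y : Type*} {mX : MeasurableSpace X} {mY : MeasurableSpace Y}
    (ρ : Measure X) [IsFiniteMeasure ρ] (κ η : Kernel X Y) [IsMarkovKernel κ] [IsMarkovKernel η]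
    (f : X → Y → ℝ≥0∞) (hf : Measurable (uncurry f)) (h : ∀ x, κ x = (η x).withDensity (f x)) :
    klDiv (ρ ⊗ₘ κ) (ρ ⊗ₘ η) = ∫⁻ x, klDiv (κ x) (η x) ∂ρ := by
  have hκ : κ = η.withDensity f := by
    ext1 x
    rw [Kernel.withDensity_apply η hf, h x]
  have : IsSFiniteKernel (η.withDensity f) := hκ ▸ inferInstance
  have hc : ρ ⊗ₘ κ = (ρ ⊗ₘ η).withDensity (uncurry f) := by
    rw [hκ, Measure.compProd_withDensity hf]
    rfl
  have hac : ρ ⊗ₘ κ ≪ ρ ⊗ₘ η := hc ▸ withDensity_absolutelyContinuous _ _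
  have hd : (ρ ⊗ₘ κ).rnDeriv (ρ ⊗ₘ η) =ᵐ[ρ ⊗ₘ η] uncurry f := by
    rw [hc]; exact Measure.rnDeriv_withDensity _ hf
  rw [klDiv_eq_lintegral_klFun_of_ac hac]
  rw [lintegral_congr_ae (g := fun p => ENNReal.ofReal (klFun (uncurry f p).toReal))
    (by filter_upwards [hd] with p hp; rw [hp])]
  rw [Measure.lintegral_compProd (by fun_prop)]
  refine lintegral_congr fun x => ?_
  have hfx : Measurable (f x) := hf.comp measurable_prodMk_left
  have hacx : κ x ≪ η x := h x ▸ withDensity_absolutelyContinuous _ _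
  rw [klDiv_eq_lintegral_klFun_of_ac hacx]
  refine lintegral_congr_ae ?_
  have hdx : (κ x).rnDeriv (η x) =ᵐ[η x] f x := by
    rw [h x]; exact Measure.rnDeriv_withDensity _ hfx
  filter_upwards [hdx] with y hy
  rw [hy]; rfl

/-- The likelihood ratio of two Gaussian distributions with the same variance. -/
theorem gaussianReal_eq_withDensity (a b : ℝ) {v : ℝ≥0} (hv : v ≠ 0) :
    gaussianReal a v = (gaussianReal b v).withDensity
      fun y => ENNReal.ofReal (Real.exp ((v : ℝ)⁻¹ * (((y - b) ^ 2 - (y - a) ^ 2) / 2))) := by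
  rw [gaussianReal_of_var_ne_zero _ hv, gaussianReal_of_var_ne_zero _ hv,
    ← withDensity_mul _ (by fun_prop) (by fun_prop)]
  congr 1
  ext y
  have hv' : (v : ℝ) ≠ 0 := by exact_mod_cast hv
  rw [Pi.mul_apply, gaussianPDF, gaussianPDF, ← ENNReal.ofReal_mul (gaussianPDFReal_nonneg _ _ _),
    gaussianPDFReal, gaussianPDFReal, mul_assoc (√_)⁻¹, ← Real.exp_add]
  congr 3
  field_simp
  ring

/-- The divergence of two Gaussian distributions with the same variance. -/
theorem klDiv_gaussianReal (a b : ℝ) {v : ℝ≥0} (hv : v ≠ 0) :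
    klDiv (gaussianReal a v) (gaussianReal b v) = ENNReal.ofReal ((a - b) ^ 2 / (2 * v)) := by
  have h := gaussianReal_eq_withDensity a b hv
  have hac : gaussianReal a v ≪ gaussianReal b v := by
    rw [h]; exact withDensity_absolutelyContinuous _ _
  have hllr : llr (gaussianReal a v) (gaussianReal b v) =ᵐ[gaussianReal a v]
      fun y => (v : ℝ)⁻¹ * (a - b) * y + (v : ℝ)⁻¹ * ((b ^ 2 - a ^ 2) / 2) := by
    have hd := Measure.rnDeriv_withDensity (gaussianReal b v) (f := fun y => ENNReal.ofReal
      (Real.exp ((v : ℝ)⁻¹ * (((y - b) ^ 2 - (y - a) ^ 2) / 2)))) (by fun_prop)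
    rw [← h] at hd
    filter_upwards [hac.ae_le hd] with y hy
    rw [llr, hy, ENNReal.toReal_ofReal (Real.exp_nonneg _), Real.log_exp]
    ring
  have hid : Integrable (fun y : ℝ => y) (gaussianReal a v) :=
    (memLp_id_gaussianReal 1).integrable le_rfl
  have hint : Integrable (llr (gaussianReal a v) (gaussianReal b v)) (gaussianReal a v) := by
    rw [integrable_congr hllr]
    exact (hid.const_mul _).add (integrable_const _)
  rw [klDiv_of_ac_of_integrable hac hint, integral_congr_ae hllr,
    integral_add (hid.const_mul _) (integrable_const _), integral_const_mul, integral_id_gaussianReal]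
  have hv' : (v : ℝ) ≠ 0 := by exact_mod_cast hv
  congr 1
  simp
  field_simp
  ring

/-- A lower bound for the relative entropy in terms of the probabilities of one event. -/
theorem mul_log_add_mul_log_le_klDiv {Ω : Type*} {mΩ : MeasurableSpace Ω} (P Q : Measure Ω)
    [IsProbabilityMeasure P] [IsProbabilityMeasure Q] (h : klDiv P Q ≠ ∞) {B : Set Ω}
    (hB : MeasurableSet B) {c d : ℝ} (hc : 0 < c) (hd : 0 < d) :
    P.real B * Real.log c + (1 - c) * Q.real B +
      (P.real Bᶜ * Real.log d + (1 - d) * Q.real Bᶜ) ≤ (klDiv P Q).toReal := by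
  obtain ⟨hac, hint⟩ := klDiv_ne_top_iff.1 h
  rw [toReal_klDiv_eq_integral_klFun hac]
  have hi : Integrable (fun x => klFun (P.rnDeriv Q x).toReal) Q :=
    (integrable_klFun_rnDeriv_iff hac).2 hint
  have hr : Integrable (fun x => (P.rnDeriv Q x).toReal) Q := Measure.integrable_toReal_rnDeriv
  have key : ∀ {C : Set Ω} {t : ℝ}, 0 < t →
      P.real C * Real.log t + (1 - t) * Q.real C ≤
        ∫ x in C, klFun (P.rnDeriv Q x).toReal ∂Q := by
    intro C t ht
    have h1 : ∫ x in C, ((P.rnDeriv Q x).toReal * Real.log t + (1 - t)) ∂Q =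
        P.real C * Real.log t + (1 - t) * Q.real C := by
      rw [integral_add (hr.integrableOn.mul_const _) (integrable_const _), integral_mul_const,
        Measure.setIntegral_toReal_rnDeriv hac]
      simp [mul_comm]
    rw [← h1]
    refine integral_mono ((hr.integrableOn.mul_const _).add (integrable_const _))
      hi.integrableOn fun x => ?_
    have h0 : 0 ≤ (P.rnDeriv Q x).toReal := ENNReal.toReal_nonneg
    generalize (P.rnDeriv Q x).toReal = r at h0
    have h2 : 0 ≤ klFun (r / t) := klFun_nonneg (by positivity)
    -- The affine part is the tangent of `klFun` at `t`; the remainder is nonnegative, which is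
    -- convexity made explicit.
    have h3 : klFun r = r * Real.log t + (1 - t) + t * klFun (r / t) := by
      rcases h0.eq_or_lt with rfl | h0
      · simp [klFun_zero]
      · rw [klFun_apply, klFun_apply, Real.log_div h0.ne' ht.ne']
        field_simp
        ring
    show r * Real.log t + (1 - t) ≤ klFun r
    rw [h3]
    have := mul_nonneg ht.le h2
    linarith
  rw [← integral_add_compl hB hi]
  exact add_le_add (key hc) (key hd)

/-- The binary case of the Bretagnolle-Huber inequality. -/
theorem exp_neg_binary_le {p q K : ℝ} (hp : 0 < p) (hp1 : p < 1) (hq : 0 < q) (hq1 : q < 1)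
    (h : p * Real.log (p / q) + (1 - p) * Real.log ((1 - p) / (1 - q)) ≤ K) :
    Real.exp (-K) ≤ 2 * (p + (1 - q)) := by
  have hp' : 0 < 1 - p := by linarith
  have hq' : 0 < 1 - q := by linarith
  -- With these values `x ^ p * y ^ (1 - p)` is the exponential of minus half the binary divergence.
  -- Weighted AM-GM bounds it by `√(p * q) + √((1 - p) * (1 - q))`.
  set x := √(q / p) with hx
  set y := √((1 - q) / (1 - p)) with hy
  have hx0 : 0 < x := Real.sqrt_pos.2 (by positivity)
  have hy0 : 0 < y := Real.sqrt_pos.2 (by positivity)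
  have lx : Real.log (p / q) = -(2 * Real.log x) := by
    rw [hx, Real.log_sqrt (by positivity), Real.log_div hp.ne' hq.ne', Real.log_div hq.ne' hp.ne']
    ring
  have ly : Real.log ((1 - p) / (1 - q)) = -(2 * Real.log y) := by
    rw [hy, Real.log_sqrt (by positivity), Real.log_div hp'.ne' hq'.ne',
      Real.log_div hq'.ne' hp'.ne']
    ring
  have hxx : p * x = √(p * q) := by
    rw [hx, eq_comm, Real.sqrt_eq_iff_mul_self_eq (by positivity) (by positivity)]
    rw [show p * √(q / p) * (p * √(q / p)) = p * p * (√(q / p) * √(q / p)) by ring,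
      Real.mul_self_sqrt (by positivity)]
    field_simp
  have hyy : (1 - p) * y = √((1 - p) * (1 - q)) := by
    rw [hy, eq_comm, Real.sqrt_eq_iff_mul_self_eq (by positivity) (by positivity)]
    rw [show (1 - p) * √((1 - q) / (1 - p)) * ((1 - p) * √((1 - q) / (1 - p))) =
      (1 - p) * (1 - p) * (√((1 - q) / (1 - p)) * √((1 - q) / (1 - p))) by ring,
      Real.mul_self_sqrt (by positivity)]
    field_simp
  have hgm := Real.geom_mean_le_arith_mean2_weighted hp.le hp'.le hx0.le hy0.le (by ring)
  have h1 : Real.exp (-K) ≤ (x ^ p * y ^ (1 - p)) ^ 2 := by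
    rw [Real.rpow_def_of_pos hx0, Real.rpow_def_of_pos hy0, ← Real.exp_add, ← Real.exp_nat_mul]
    apply Real.exp_le_exp.2
    rw [lx, ly] at h
    push_cast
    linarith
  have hz : p * x + (1 - p) * y ≤ √p + √(1 - q) := by
    rw [hxx, hyy]
    exact add_le_add (Real.sqrt_le_sqrt (by nlinarith)) (Real.sqrt_le_sqrt (by nlinarith))
  calc Real.exp (-K) ≤ (x ^ p * y ^ (1 - p)) ^ 2 := h1
    _ ≤ (√p + √(1 - q)) ^ 2 := by
      have : 0 ≤ x ^ p * y ^ (1 - p) := by positivity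
      exact pow_le_pow_left₀ this (hgm.trans hz) 2
    _ ≤ 2 * (√p ^ 2 + √(1 - q) ^ 2) := by nlinarith [sq_nonneg (√p - √(1 - q))]
    _ = 2 * (p + (1 - q)) := by rw [Real.sq_sqrt hp.le, Real.sq_sqrt hq'.le]

/-- The **Bretagnolle-Huber inequality**. -/
theorem exp_neg_klDiv_le {Ω : Type*} {mΩ : MeasurableSpace Ω} (P Q : Measure Ω)
    [IsProbabilityMeasure P] [IsProbabilityMeasure Q] (h : klDiv P Q ≠ ∞) {B : Set Ω}
    (hB : MeasurableSet B) :
    Real.exp (-(klDiv P Q).toReal) ≤ 2 * (P.real B + Q.real Bᶜ) := by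
  have hac := (klDiv_ne_top_iff.1 h).1
  have key := fun c d hc hd => mul_log_add_mul_log_le_klDiv P Q h hB (c := c) (d := d) hc hd
  have h1 : Real.exp (-(klDiv P Q).toReal) ≤ 1 :=
    Real.exp_le_one_iff.2 (neg_nonpos.2 ENNReal.toReal_nonneg)
  rw [probReal_compl_eq_one_sub hB, probReal_compl_eq_one_sub hB] at *
  have zero_of : ∀ {C : Set Ω}, Q.real C = 0 → P.real C = 0 := by
    intro C hC
    rw [measureReal_eq_zero_iff] at hC ⊢
    exact hac hC
  have hp0 : 0 ≤ P.real B := measureReal_nonneg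
  have hp1 : P.real B ≤ 1 := measureReal_le_one
  have hq0 : 0 ≤ Q.real B := measureReal_nonneg
  have hq1 : Q.real B ≤ 1 := measureReal_le_one
  have hz := zero_of (C := B)
  have hz' := zero_of (C := Bᶜ)
  rw [probReal_compl_eq_one_sub hB, probReal_compl_eq_one_sub hB] at hz'
  generalize P.real B = p at *
  generalize Q.real B = q at *
  rcases hp1.eq_or_lt with rfl | hp1
  · linarith
  rcases hq1.eq_or_lt with rfl | hq1
  · linarith [hz' (by ring)]
  rcases hp0.eq_or_lt with rfl | hp0
  · have hq' : 0 < 1 - q := by linarith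
    have h2 : 0 < Real.log 2 := Real.log_pos (by norm_num)
    -- Since `p = 0`, the first parameter `c` only costs `c * q ≤ c`. The choice `c = log 2` makes
    -- this cost at most the factor 2 of the claim.
    have h3 := key (Real.log 2) (1 - q)⁻¹ h2 (by positivity)
    have e1 : (1 - (1 - q)⁻¹) * (1 - q) = -q := by field_simp; ring
    rw [Real.log_inv] at h3
    calc Real.exp (-(klDiv P Q).toReal) ≤ Real.exp (Real.log 2 + Real.log (1 - q)) :=
          Real.exp_le_exp.2 (by nlinarith)
      _ = 2 * (0 + (1 - q)) := by
          rw [Real.exp_add, Real.exp_log two_pos, Real.exp_log hq', zero_add]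
  rcases hq0.eq_or_lt with rfl | hq0
  · linarith [hz rfl]
  refine exp_neg_binary_le hp0 hp1 hq0 hq1 ?_
  have hp' : 0 < 1 - p := by linarith
  have hq' : 0 < 1 - q := by linarith
  -- Tangents at the average density on `B` and on its complement: the linear corrections cancel and
  -- the binary divergence remains.
  have := key (p / q) ((1 - p) / (1 - q)) (by positivity) (by positivity)
  have e1 : (1 - p / q) * q = q - p := by field_simp
  have e2 : (1 - (1 - p) / (1 - q)) * (1 - q) = p - q := by field_simp; ring
  linarith

/-! ### The information in the records -/

section Model

variable {ι : Type*} [Fintype ι] [DecidableEq ι] [MeasurableSpace ι] [MeasurableSingletonClass ι]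

/-- The divergence of the outcomes of a measurement under the supports `S` and `S'`. -/
noncomputable def outcomeDiv (μ : ℝ) (S S' : Finset ι) (q : ι × ℝ≥0) : ℝ≥0∞ :=
  ENNReal.ofReal (q.2 * (signal μ S q.1 - signal μ S' q.1) ^ 2 / 2)

theorem measurable_signal_fst {β : Type*} [MeasurableSpace β] (μ : ℝ) (S : Finset ι) :
    Measurable fun q : ι × β => signal μ S q.1 :=
  (measurable_of_finite (signal μ S)).comp measurable_fst

theorem measurable_outcomeDiv (μ : ℝ) (S S' : Finset ι) : Measurable (outcomeDiv μ S S') := by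
  have h := measurable_signal_fst (β := ℝ≥0) μ S
  have h' := measurable_signal_fst (β := ℝ≥0) μ S'
  unfold outcomeDiv
  fun_prop

theorem outcomeKernel_apply (μ : ℝ) (S : Finset ι) (q : ι × ℝ≥0) :
    outcomeKernel μ S q = if q.2 = 0 then Measure.dirac 0
      else gaussianReal (signal μ S q.1) q.2⁻¹ := rfl

/-- The likelihood ratio of the outcomes of a measurement. -/
theorem outcomeKernel_eq_withDensity (μ : ℝ) (S S' : Finset ι) (q : ι × ℝ≥0) :
    outcomeKernel μ S q = (outcomeKernel μ S' q).withDensity fun y =>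
      ENNReal.ofReal (Real.exp (q.2 *
        (((y - signal μ S' q.1) ^ 2 - (y - signal μ S q.1) ^ 2) / 2))) := by
  rw [outcomeKernel_apply, outcomeKernel_apply]
  split_ifs with h
  · simp [h, withDensity_const]
  · rw [gaussianReal_eq_withDensity (signal μ S q.1) (signal μ S' q.1) (inv_ne_zero h)]
    simp

theorem klDiv_outcomeKernel (μ : ℝ) (S S' : Finset ι) (q : ι × ℝ≥0) :
    klDiv (outcomeKernel μ S q) (outcomeKernel μ S' q) = outcomeDiv μ S S' q := by
  rw [outcomeKernel_apply, outcomeKernel_apply, outcomeDiv]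
  split_ifs with h
  · simp [h]
  · rw [klDiv_gaussianReal _ _ (inv_ne_zero h)]
    congr 1
    push_cast
    field_simp

/-- The map `q` reads the measured pair off a larger history: it is the identity for the first
record and the second projection for later ones. -/
theorem klDiv_compProd_outcomeKernel_comap {X : Type*} {mX : MeasurableSpace X} (ρ : Measure X)
    [IsFiniteMeasure ρ] (μ : ℝ) (S S' : Finset ι) {q : X → ι × ℝ≥0} (hq : Measurable q) :
    klDiv (ρ ⊗ₘ (outcomeKernel μ S).comap q hq) (ρ ⊗ₘ (outcomeKernel μ S').comap q hq) =
      ∫⁻ x, outcomeDiv μ S S' (q x) ∂ρ := by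
  rw [klDiv_compProd_withDensity ρ _ _ (fun x y => ENNReal.ofReal (Real.exp ((q x).2 *
        (((y - signal μ S' (q x).1) ^ 2 - (y - signal μ S (q x).1) ^ 2) / 2))))]
  · simp_rw [Kernel.comap_apply, klDiv_outcomeKernel]
  · have h : Measurable fun x => signal μ S (q x).1 := (measurable_signal_fst μ S).comp hq
    have h' : Measurable fun x => signal μ S' (q x).1 := (measurable_signal_fst μ S').comp hq
    unfold uncurry
    fun_prop
  · intro x
    exact outcomeKernel_eq_withDensity μ S S' (q x)

/-! ### Divergence of the laws of finitely many records, and passage to the infinite sequence. -/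

namespace Procedure

variable (π : Procedure ι) (μ : ℝ)

/-- The law of the record at time `j + 1`, given the records up to time `j`. -/
noncomputable def step (S : Finset ι) (j : ℕ) :
    Kernel ((i : Finset.Iic j) → Record ι) (Record ι) :=
  π.next j ⊗ₖ (outcomeKernel μ S).prodMkLeft ((i : Finset.Iic j) → Record ι)

instance (S : Finset ι) (j : ℕ) : IsMarkovKernel (π.step μ S j) := by
  unfold step; infer_instance

instance (S : Finset ι) : IsProbabilityMeasure (π.law μ S) := by
  unfold law; infer_instance

/-- The joint law of the records up to time `n`. -/
noncomputable def lawUpTo (S : Finset ι) (n : ℕ) : Measure ((i : Finset.Iic n) → Record ι) :=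
  (π.law μ S).map (Preorder.frestrictLe (π := fun _ => Record ι) n)

instance (S : Finset ι) (n : ℕ) : IsProbabilityMeasure (π.lawUpTo μ S n) :=
  Measure.isProbabilityMeasure_map (by fun_prop)

theorem lawUpTo_compProd_step (S : Finset ι) (n : ℕ) :
    π.lawUpTo μ S n ⊗ₘ π.step μ S n = (π.law μ S).map
      fun ω => (Preorder.frestrictLe (π := fun _ => Record ι) n ω, ω (n + 1)) :=
  Kernel.map_frestrictLe_trajMeasure_compProd_eq_map_trajMeasure (X := fun _ => Record ι)

/-- The record at time `0` is the first pair together with its outcome. -/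
theorem lawUpTo_zero (S : Finset ι) : π.lawUpTo μ S 0 = (π.first ⊗ₘ outcomeKernel μ S).map
    (MeasurableEquiv.piUnique fun _ : Finset.Iic 0 => Record ι).symm := by
  unfold lawUpTo law Kernel.trajMeasure
  rw [Measure.map_comp _ _ (by fun_prop), Kernel.traj_map_frestrictLe, Kernel.partialTraj_self]
  exact Measure.id_comp

theorem map_law_zero (S : Finset ι) :
    (π.law μ S).map (fun ω => ω 0) = π.first ⊗ₘ outcomeKernel μ S := by
  have h : (fun ω : ℕ → Record ι => ω 0) =
      (MeasurableEquiv.piUnique fun _ : Finset.Iic 0 => Record ι) ∘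
        Preorder.frestrictLe (π := fun _ => Record ι) 0 := rfl
  rw [h, ← Measure.map_map (by fun_prop) (by fun_prop)]
  change (π.lawUpTo μ S 0).map _ = _
  rw [lawUpTo_zero, Measure.map_map (by fun_prop) (by fun_prop),
    MeasurableEquiv.self_comp_symm, Measure.map_id]

theorem klDiv_lawUpTo_zero_le (S S' : Finset ι) :
    klDiv (π.lawUpTo μ S 0) (π.lawUpTo μ S' 0) ≤
      ∫⁻ ω, outcomeDiv μ S S' (ω 0).1 ∂π.law μ S := by
  have hm := measurable_outcomeDiv μ S S'
  rw [lawUpTo_zero, lawUpTo_zero]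
  refine (klDiv_map_le _ _ (by fun_prop)).trans ?_
  have h := klDiv_compProd_outcomeKernel_comap π.first μ S S' measurable_id
  simp only [Kernel.comap_id] at h
  rw [h, ← lintegral_map (μ := π.law μ S) (f := fun r : Record ι => outcomeDiv μ S S' r.1)
    (g := fun ω => ω 0) (by fun_prop) (by fun_prop), map_law_zero,
    Measure.lintegral_compProd (by fun_prop)]
  simp

/-- Chain rule: given the past, the next pair `(A, Γ)` has the same law under both supports, so only
the outcome adds divergence. -/
theorem klDiv_lawUpTo_succ_le (S S' : Finset ι) (n : ℕ) :
    klDiv (π.lawUpTo μ S (n + 1)) (π.lawUpTo μ S' (n + 1)) ≤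
      klDiv (π.lawUpTo μ S n) (π.lawUpTo μ S' n) +
        ∫⁻ ω, outcomeDiv μ S S' (ω (n + 1)).1 ∂π.law μ S := by
  have hm := measurable_outcomeDiv μ S S'
  let g : ((i : Finset.Iic n) → Record ι) × Record ι → (i : Finset.Iic (n + 1)) → Record ι :=
    fun p i => if h : (i : ℕ) ≤ n then p.1 ⟨i, Finset.mem_Iic.2 h⟩ else p.2
  have hg : Measurable g := by
    refine measurable_pi_lambda _ fun i => ?_
    by_cases h : (i : ℕ) ≤ n
    · simp only [g, h, dite_true]; fun_prop
    · simp only [g, h, dite_false]; fun_prop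
  have hmap : ∀ R : Finset ι, π.lawUpTo μ R (n + 1) =
      (π.lawUpTo μ R n ⊗ₘ π.step μ R n).map g := by
    intro R
    rw [lawUpTo_compProd_step, Measure.map_map hg (by fun_prop), lawUpTo]
    congr 1
    ext1 ω
    ext1 i
    by_cases h : (i : ℕ) ≤ n
    · simp [g, h]
    · have hi : (i : ℕ) = n + 1 := le_antisymm (Finset.mem_Iic.1 i.2) (by omega)
      simp [g, hi]
  rw [hmap S, hmap S']
  refine (klDiv_map_le _ _ hg).trans ?_
  rw [klDiv_compProd_eq_add]
  gcongr
  -- The chain rule averages over the past under `S` in both terms. Grouping `π.next n` with that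
  -- past leaves a common first factor, and only the outcome kernels differ.
  have hassoc : ∀ R : Finset ι, π.lawUpTo μ S n ⊗ₘ π.step μ R n =
      ((π.lawUpTo μ S n ⊗ₘ π.next n) ⊗ₘ (outcomeKernel μ R).prodMkLeft _).map
        MeasurableEquiv.prodAssoc := fun R => Measure.compProd_assoc'.symm
  rw [hassoc S, hassoc S']
  refine (klDiv_map_le _ _ (by fun_prop)).trans ?_
  rw [Kernel.prodMkLeft, Kernel.prodMkLeft, klDiv_compProd_outcomeKernel_comap]
  rw [← lintegral_map (μ := π.law μ S) (f := fun r : ((i : Finset.Iic n) → Record ι) × Record ι =>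
      outcomeDiv μ S S' r.2.1)
    (g := fun ω => (Preorder.frestrictLe (π := fun _ => Record ι) n ω, ω (n + 1)))
    (by fun_prop) (by fun_prop), ← lawUpTo_compProd_step, hassoc S,
    lintegral_map (by fun_prop) (by fun_prop)]
  refine ((Measure.lintegral_compProd (by fun_prop)).trans ?_).ge
  simp [MeasurableEquiv.prodAssoc]

theorem klDiv_lawUpTo_le (S S' : Finset ι) (n : ℕ) :
    klDiv (π.lawUpTo μ S n) (π.lawUpTo μ S' n) ≤
      ∫⁻ ω, ∑' j, outcomeDiv μ S S' (ω j).1 ∂π.law μ S := by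
  have hm := measurable_outcomeDiv μ S S'
  have h : klDiv (π.lawUpTo μ S n) (π.lawUpTo μ S' n) ≤
      ∑ j ∈ Finset.range (n + 1), ∫⁻ ω, outcomeDiv μ S S' (ω j).1 ∂π.law μ S := by
    induction n with
    | zero => simpa using klDiv_lawUpTo_zero_le π μ S S'
    | succ n ih =>
      rw [Finset.sum_range_succ]
      exact (klDiv_lawUpTo_succ_le π μ S S' n).trans (by gcongr)
  have hj : ∀ j, Measurable fun ω : ℕ → Record ι => outcomeDiv μ S S' (ω j).1 :=
    fun j => hm.comp (by fun_prop)
  rw [lintegral_tsum fun j => (hj j).aemeasurable]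
  exact h.trans (ENNReal.sum_le_tsum _)

/-- No event can tell the supports `S` and `S'` apart better than their divergence allows. -/
theorem exp_neg_le_law (S S' : Finset ι) {K : ℝ} (hK : 0 ≤ K)
    (h : ∫⁻ ω, ∑' j, outcomeDiv μ S S' (ω j).1 ∂π.law μ S ≤ ENNReal.ofReal K)
    {B : Set (ℕ → Record ι)} (hB : MeasurableSet B) :
    Real.exp (-K) ≤ 2 * ((π.law μ S).real B + (π.law μ S').real Bᶜ) := by
  refine le_of_forall_pos_le_add fun δ hδ => ?_
  -- The event may depend on infinitely many records. It is approximated by a cylinder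
  -- simultaneously under both laws; the tolerance `δ / 2` becomes `δ` through the factor 2 of
  -- Bretagnolle-Huber.
  have hd : (π.law μ S + π.law μ S').MeasureDense (measurableCylinders fun _ : ℕ => Record ι) :=
    Measure.MeasureDense.of_generateFrom_isSetAlgebra_finite _
      isSetAlgebra_measurableCylinders generateFrom_measurableCylinders.symm
  obtain ⟨C, hC, hBC⟩ := hd.approx B hB (measure_ne_top _ _) (δ / 2) (by positivity)
  have hCm := hd.measurable C hC
  rw [measurableCylinders_nat] at hC
  simp only [Set.mem_iUnion, Set.mem_singleton_iff] at hC
  obtain ⟨n, D, hD, rfl⟩ := hC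
  have hkl := (klDiv_lawUpTo_le π μ S S' n).trans h
  have hbh := exp_neg_klDiv_le _ _ (ne_top_of_le_ne_top ENNReal.ofReal_ne_top hkl) hD
  have hKl : (klDiv (π.lawUpTo μ S n) (π.lawUpTo μ S' n)).toReal ≤ K :=
    ENNReal.toReal_le_of_le_ofReal hK hkl
  have hmap : ∀ (R : Finset ι) {A : Set ((i : Finset.Iic n) → Record ι)}, MeasurableSet A →
      (π.lawUpTo μ R n).real A = (π.law μ R).real (cylinder (Finset.Iic n) A) := fun R A hA =>
    map_measureReal_apply (by fun_prop) hA
  rw [hmap S hD, hmap S' hD.compl, ← compl_cylinder] at hbh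
  set C := cylinder (α := fun _ => Record ι) (Finset.Iic n) D
  have hsd : (π.law μ S).real (symmDiff B C) + (π.law μ S').real (symmDiff B C) ≤ δ / 2 := by
    rw [Measure.add_apply] at hBC
    rw [measureReal_def, measureReal_def, ← ENNReal.toReal_add (by finiteness) (by finiteness)]
    exact ENNReal.toReal_le_of_le_ofReal (by positivity) hBC.le
  have h1 : (π.law μ S).real C ≤ (π.law μ S).real B + (π.law μ S).real (symmDiff B C) := by
    refine (measureReal_mono ?_).trans (measureReal_union_le _ _)
    intro x hx
    by_cases hxB : x ∈ B
    · exact Or.inl hxB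
    · exact Or.inr (Or.inr ⟨hx, hxB⟩)
  have h2 : (π.law μ S').real Cᶜ ≤ (π.law μ S').real Bᶜ + (π.law μ S').real (symmDiff B C) := by
    refine (measureReal_mono ?_).trans (measureReal_union_le _ _)
    intro x hx
    by_cases hxB : x ∈ B
    · exact Or.inr (Or.inl ⟨hxB, hx⟩)
    · exact Or.inl hxB
  have h3 := Real.exp_le_exp.2 (neg_le_neg hKl)
  linarith

end Procedure

end Model

theorem outcomeDiv_union {ι : Type*} [DecidableEq ι] {μ : ℝ} {S T : Finset ι} (h : Disjoint S T) (q : ι × ℝ≥0) :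
    outcomeDiv μ S (S ∪ T) q = ENNReal.ofReal (μ ^ 2 / 2) * if q.1 ∈ T then (q.2 : ℝ≥0∞) else 0 := by
  unfold outcomeDiv signal
  by_cases hT : q.1 ∈ T
  · have hS : q.1 ∉ S := Finset.disjoint_right.1 h hT
    rw [if_neg hS, if_pos (Finset.mem_union_right S hT), if_pos hT, ← ENNReal.ofReal_coe_nnreal,
      ← ENNReal.ofReal_mul (by positivity)]
    congr 1
    ring
  · simp [hT]

/-! ### The number of disjoint stars -/

section Stars

variable {p s : ℕ}

theorem AreDisjointStars.mul_le_card {N : ℕ} {T : Fin N → Finset (Edge p)}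
    (h : AreDisjointStars s T) : N * s ≤ Fintype.card (Edge p) := by
  calc N * s = (Finset.univ.biUnion T).card := by
        rw [Finset.card_biUnion fun i _ j _ hij => h.2 hij]
        simp [(h.1 _).1]
    _ ≤ _ := Finset.card_le_univ _

/-- Boundedness makes the supremum a maximum; an unbounded set would have `sSup` equal to the
default 0. -/
theorem bddAbove_disjointStars (p : ℕ) (hs : 1 ≤ s) :
    BddAbove {N : ℕ | ∃ T : Fin N → Finset (Edge p), AreDisjointStars s T} := by
  refine ⟨Fintype.card (Edge p), ?_⟩
  rintro N ⟨T, hT⟩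
  exact (Nat.le_mul_of_pos_right N hs).trans hT.mul_le_card

theorem exists_maxDisjointStars (p : ℕ) (hs : 1 ≤ s) :
    ∃ T : Fin (maxDisjointStars p s) → Finset (Edge p), AreDisjointStars s T :=
  Nat.sSup_mem (s := {N : ℕ | ∃ T : Fin N → Finset (Edge p), AreDisjointStars s T})
    ⟨0, Fin.elim0, fun i => i.elim0, fun i => i.elim0⟩ (bddAbove_disjointStars p hs)

theorem card_filter_mem_edge (e : Edge p) :
    (Finset.univ.filter fun v : Fin p => v ∈ (e : Sym2 (Fin p))).card = 2 := by
  rw [← Sym2.card_toFinset_of_not_isDiag _ (SimpleGraph.not_isDiag_of_mem_edgeSet _ e.2)]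
  congr 1
  ext v
  simp

theorem card_edge (p : ℕ) : Fintype.card (Edge p) = p.choose 2 := by
  have h := SimpleGraph.card_edgeFinset_top_eq_card_choose_two (V := Fin p)
  rw [Fintype.card_fin] at h
  rw [← h, SimpleGraph.edgeFinset, Set.toFinset_card]

/-- In a maximal family of disjoint stars, every vertex is on fewer than `s` of the other edges. -/
theorem card_filter_mem_lt_of_maximal (hs : 1 ≤ s)
    {T : Fin (maxDisjointStars p s) → Finset (Edge p)} (hT : AreDisjointStars s T) (v : Fin p) :
    ((Finset.univ.biUnion T)ᶜ.filter fun e : Edge p => v ∈ (e : Sym2 (Fin p))).card < s := by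
  by_contra! h
  -- These `s` uncovered edges at `v` form a star that enlarges the family.
  obtain ⟨A, hA, hAs⟩ := Finset.exists_subset_card_eq h
  have hdisj : ∀ i, Disjoint A (T i) := fun i => by
    rw [Finset.disjoint_left]
    intro e he hi
    have := (Finset.mem_filter.1 (hA he)).1
    exact Finset.mem_compl.1 this (Finset.mem_biUnion.2 ⟨i, Finset.mem_univ i, hi⟩)
  have hN : AreDisjointStars s (Fin.cons A T : Fin (maxDisjointStars p s + 1) → _) := by
    refine ⟨fun i => ?_, fun i j hij => ?_⟩
    · cases i using Fin.cases with
      | zero => exact ⟨hAs, v, fun e he => (Finset.mem_filter.1 (hA he)).2⟩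
      | succ i => exact hT.1 i
    · cases i using Fin.cases with
      | zero =>
        cases j using Fin.cases with
        | zero => exact absurd rfl hij
        | succ j => exact hdisj j
      | succ i =>
        cases j using Fin.cases with
        | zero => exact (hdisj i).symm
        | succ j => exact hT.2 fun h => hij (congrArg _ h)
  have := le_csSup (bddAbove_disjointStars p hs) ⟨_, hN⟩
  exact absurd this (Nat.not_succ_le_self _)

/-- Double counting: the uncovered degrees sum to twice the number of uncovered edges, and each is
below `s`. -/
theorem le_maxDisjointStars (p : ℕ) (hs : 1 ≤ s) :
    (p : ℝ) * (p - 1 - s) / (2 * s) ≤ maxDisjointStars p s := by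
  obtain ⟨T, hT⟩ := exists_maxDisjointStars p hs
  have hcard : (Finset.univ.biUnion T).card = maxDisjointStars p s * s := by
    rw [Finset.card_biUnion fun i _ j _ hij => hT.2 hij]
    simp [(hT.1 _).1]
  have htot := Finset.card_add_card_compl (Finset.univ.biUnion T)
  rw [hcard, card_edge] at htot
  have hdc : ∑ v : Fin p,
      ((Finset.univ.biUnion T)ᶜ.filter fun e : Edge p => v ∈ (e : Sym2 (Fin p))).card =
        (Finset.univ.biUnion T)ᶜ.card * 2 := by
    simp_rw [Finset.card_filter]
    rw [Finset.sum_comm]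
    simp_rw [← Finset.card_filter, card_filter_mem_edge]
    simp
  have hle : (Finset.univ.biUnion T)ᶜ.card * 2 ≤ p * s := by
    rw [← hdc]
    refine (Finset.sum_le_card_nsmul _ _ s fun v _ =>
      (card_filter_mem_lt_of_maximal hs hT v).le).trans ?_
    simp
  have hs' : (0 : ℝ) < s := by exact_mod_cast hs
  rw [div_le_iff₀ (by positivity)]
  have h1 : ((maxDisjointStars p s * s + (Finset.univ.biUnion T)ᶜ.card : ℕ) : ℝ) = p * (p - 1) / 2 := by
    rw [htot, Nat.cast_choose_two]
  have h2 : (((Finset.univ.biUnion T)ᶜ.card * 2 : ℕ) : ℝ) ≤ (p * s : ℕ) := by exact_mod_cast hle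
  push_cast at h1 h2
  linarith

end Stars

/-! ### The lower bound for unions of disjoint sets -/

/-- Counting the pairs of a set with one of its elements by the set without the element. -/
theorem sum_powersetCard_succ_sum_mem {α M : Type*} [Fintype α] [DecidableEq α] [AddCommMonoid M]
    (k : ℕ) (b : Finset α → α → M) :
    ∑ I ∈ Finset.powersetCard k Finset.univ, ∑ i ∈ Iᶜ, b (insert i I) i =
      ∑ J ∈ Finset.powersetCard (k + 1) Finset.univ, ∑ i ∈ J, b J i := by
  rw [Finset.sum_sigma', Finset.sum_sigma']
  refine Finset.sum_bij' (fun x _ => ⟨insert x.2 x.1, x.2⟩) (fun x _ => ⟨x.1.erase x.2, x.2⟩)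
    ?_ ?_ ?_ ?_ ?_
  · rintro ⟨I, i⟩ h
    simp only [Finset.mem_sigma, Finset.mem_powersetCard_univ, Finset.mem_compl] at h ⊢
    exact ⟨by rw [Finset.card_insert_of_notMem h.2, h.1], Finset.mem_insert_self _ _⟩
  · rintro ⟨J, i⟩ h
    simp only [Finset.mem_sigma, Finset.mem_powersetCard_univ, Finset.mem_compl] at h ⊢
    exact ⟨by rw [Finset.card_erase_of_mem h.2, h.1, Nat.add_sub_cancel],
      Finset.notMem_erase _ _⟩
  · rintro ⟨I, i⟩ h
    simp only [Finset.mem_sigma, Finset.mem_compl] at h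
    simp [Finset.erase_insert h.2]
  · rintro ⟨J, i⟩ h
    simp only [Finset.mem_sigma] at h
    simp [Finset.insert_erase h.2]
  · rintro ⟨I, i⟩ h
    rfl

/-- If the errors of the two kinds are bounded by `ε` for every set, but add up to at least `L` for
every set together with its enlargements by one element, then `L` cannot be large. -/
theorem le_of_sum_errors_le {N k : ℕ} (hk : k < N) {ε L : ℝ} (a b : Finset (Fin N) → Fin N → ℝ)
    (ha : ∀ I : Finset (Fin N), I.card = k → ∑ i ∈ Iᶜ, a I i ≤ ε)
    (hb : ∀ J : Finset (Fin N), J.card = k + 1 → ∑ i ∈ J, b J i ≤ ε)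
    (hL : ∀ I : Finset (Fin N), I.card = k → L ≤ ∑ i ∈ Iᶜ, (a I i + b (insert i I) i)) :
    L * (k + 1) ≤ ε * (N + 1) := by
  have h1 : (N.choose k : ℝ) * L ≤ N.choose k * ε + N.choose (k + 1) * ε := by
    calc (N.choose k : ℝ) * L = ∑ I ∈ Finset.powersetCard k (Finset.univ : Finset (Fin N)), L := by
          simp
      _ ≤ ∑ I ∈ Finset.powersetCard k Finset.univ, ∑ i ∈ Iᶜ, (a I i + b (insert i I) i) :=
          Finset.sum_le_sum fun I hI => hL I (Finset.mem_powersetCard_univ.1 hI)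
      _ = ∑ I ∈ Finset.powersetCard k Finset.univ, ∑ i ∈ Iᶜ, a I i +
          ∑ J ∈ Finset.powersetCard (k + 1) Finset.univ, ∑ i ∈ J, b J i := by
          simp_rw [Finset.sum_add_distrib]
          rw [sum_powersetCard_succ_sum_mem]
      _ ≤ ∑ I ∈ Finset.powersetCard k (Finset.univ : Finset (Fin N)), ε +
          ∑ J ∈ Finset.powersetCard (k + 1) (Finset.univ : Finset (Fin N)), ε :=
          add_le_add
            (Finset.sum_le_sum fun I hI => ha I (Finset.mem_powersetCard_univ.1 hI))
            (Finset.sum_le_sum fun J hJ => hb J (Finset.mem_powersetCard_univ.1 hJ))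
      _ = _ := by simp
  -- This is the source of `N + 1`: after division by `N.choose k`, the two error budgets weigh `k +
  -- 1` and `N - k`.
  have h2 : (N.choose (k + 1) : ℝ) * (k + 1) = N.choose k * (N - k) := by
    have := Nat.choose_succ_right_eq N k
    rw [← Nat.cast_sub hk.le]
    exact_mod_cast this
  have h3 : (0 : ℝ) < N.choose k := by exact_mod_cast Nat.choose_pos hk.le
  refine le_of_mul_le_mul_left ?_ h3
  calc (N.choose k : ℝ) * (L * (k + 1)) = N.choose k * L * (k + 1) := by ring
    _ ≤ (N.choose k * ε + N.choose (k + 1) * ε) * (k + 1) := by gcongr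
    _ = N.choose k * ε * (k + 1) + (N.choose (k + 1) * (k + 1)) * ε := by ring
    _ = N.choose k * (ε * (N + 1)) := by rw [h2]; ring

/-- A form of Jensen's inequality for the exponential function. -/
theorem card_mul_exp_neg_le_sum {α : Type*} (A : Finset α) (x : α → ℝ) {c : ℝ}
    (h : ∑ i ∈ A, x i ≤ A.card * c) : A.card * Real.exp (-c) ≤ ∑ i ∈ A, Real.exp (-x i) := by
  -- Tangent line of `exp (-x)` at `c`; its negative slope is why an upper bound on the sum of the
  -- `x i` suffices.
  have h1 : ∀ i ∈ A, Real.exp (-c) * (1 + c - x i) ≤ Real.exp (-x i) := by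
    intro i _
    have : Real.exp (-x i) = Real.exp (-c) * Real.exp (c - x i) := by
      rw [← Real.exp_add]; ring_nf
    rw [this]
    gcongr
    linarith [Real.add_one_le_exp (c - x i)]
  refine le_trans ?_ (Finset.sum_le_sum h1)
  rw [← Finset.mul_sum, Finset.sum_sub_distrib, Finset.sum_const, nsmul_eq_mul, mul_comm]
  gcongr
  linarith

/-! ### Precision and error shared among disjoint sets of coordinates. -/

namespace Procedure

variable {ι : Type*} [Fintype ι] [DecidableEq ι] [MeasurableSpace ι] [MeasurableSingletonClass ι]
  (π : Procedure ι) (μ : ℝ)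

/-- The expected precision that is spent on the coordinates in `T`. -/
noncomputable def expectedPrecisionOn (S T : Finset ι) : ℝ≥0∞ :=
  ∫⁻ ω, ∑' j, (if (ω j).1.1 ∈ T then ((ω j).1.2 : ℝ≥0∞) else 0) ∂(π.law μ S)

theorem measurable_precisionOn (T : Finset ι) (j : ℕ) :
    Measurable fun ω : ℕ → Record ι => if (ω j).1.1 ∈ T then ((ω j).1.2 : ℝ≥0∞) else 0 := by
  have h : MeasurableSet {i : ι | i ∈ T} := Set.Finite.measurableSet (Set.toFinite _)
  have h' : MeasurableSet {ω : ℕ → Record ι | (ω j).1.1 ∈ T} :=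
    (show Measurable fun ω : ℕ → Record ι => (ω j).1.1 by fun_prop) h
  exact Measurable.ite h' (by fun_prop) measurable_const

/-- Each measured coordinate lies in at most one of the disjoint sets. -/
theorem sum_expectedPrecisionOn_le {α : Type*} (S : Finset ι) (A : Finset α) (T : α → Finset ι)
    (hT : (A : Set α).PairwiseDisjoint T) :
    ∑ i ∈ A, π.expectedPrecisionOn μ S (T i) ≤ π.expectedPrecision μ S := by
  unfold expectedPrecisionOn expectedPrecision
  rw [← lintegral_finsetSum _ fun i _ =>
    Measurable.tsum fun j => measurable_precisionOn (T i) j]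
  refine lintegral_mono fun ω => ?_
  rw [← Summable.tsum_finsetSum fun i _ => ENNReal.summable]
  refine ENNReal.tsum_le_tsum fun j => ?_
  by_cases h : ∃ i ∈ A, (ω j).1.1 ∈ T i
  · obtain ⟨i, hi, hij⟩ := h
    rw [Finset.sum_eq_single_of_mem i hi, if_pos hij]
    intro i' hi' hne
    refine if_neg fun h' => ?_
    exact Finset.disjoint_left.1 (hT hi' hi hne) h' hij
  · push Not at h
    rw [Finset.sum_eq_zero fun i hi => if_neg (h i hi)]
    exact zero_le

theorem lintegral_outcomeDiv_union {S T : Finset ι} (h : Disjoint S T) :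
    ∫⁻ ω, ∑' j, outcomeDiv μ S (S ∪ T) (ω j).1 ∂π.law μ S =
      ENNReal.ofReal (μ ^ 2 / 2) * π.expectedPrecisionOn μ S T := by
  simp_rw [outcomeDiv_union h, ENNReal.tsum_mul_left]
  rw [lintegral_const_mul _ (Measurable.tsum fun j => measurable_precisionOn T j)]
  rfl

theorem sum_measure_le_expectedError (S : Finset ι) (A : Finset ι) :
    ∑ e ∈ A, π.law μ S {ω | e ∈ symmDiff (π.estimator ω) S} ≤ π.expectedError μ S := by
  have hm : ∀ e, MeasurableSet {ω | e ∈ symmDiff (π.estimator ω) S} := by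
    intro e
    by_cases he : e ∈ S
    · convert (π.measurable_estimator e).compl using 1
      ext ω
      simp [Finset.mem_symmDiff, he]
    · convert π.measurable_estimator e using 1
      ext ω
      simp [Finset.mem_symmDiff, he]
  simp_rw [← fun e => lintegral_indicator_one (μ := π.law μ S) (hm e)]
  rw [← lintegral_finsetSum _ fun e _ => measurable_one.indicator (hm e)]
  refine lintegral_mono fun ω => ?_
  calc ∑ e ∈ A, {ω | e ∈ symmDiff (π.estimator ω) S}.indicator (1 : (ℕ → Record ι) → ℝ≥0∞) ω
      = ((A.filter fun e => e ∈ symmDiff (π.estimator ω) S).card : ℝ≥0∞) := by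
        simp [Set.indicator_apply, Finset.card_filter]
    _ ≤ ((symmDiff (π.estimator ω) S).card : ℝ≥0∞) := by
        exact_mod_cast Finset.card_le_card fun e he => (Finset.mem_filter.1 he).2

variable {N : ℕ} {T : Fin N → Finset ι}

/-- The errors on disjoint sets of coordinates add up to at most the total error. -/
theorem sum_sum_real_le (hT : Pairwise fun i j => Disjoint (T i) (T j)) {S : Finset ι} {ε : ℝ}
    (hε : 0 ≤ ε) (h : π.expectedError μ S ≤ ENNReal.ofReal ε) (I : Finset (Fin N)) :
    ∑ i ∈ I, ∑ e ∈ T i, (π.law μ S).real {ω | e ∈ symmDiff (π.estimator ω) S} ≤ ε := by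
  rw [← Finset.sum_biUnion fun i _ j _ hij => hT hij]
  simp_rw [measureReal_def]
  rw [← ENNReal.toReal_sum fun _ _ => measure_ne_top _ _]
  exact ENNReal.toReal_le_of_le_ofReal hε ((π.sum_measure_le_expectedError μ S _).trans h)

/-- Every `e ∈ U` gives a test of `S` against `S ∪ U`, namely whether `e` is in the estimate, and
all these tests face the same divergence. The bound `hG` serves to make `toReal` faithful. -/
theorem card_mul_exp_neg_le {S U : Finset ι} (hSU : Disjoint S U) {m : ℝ}
    (hG : π.expectedPrecisionOn μ S U ≤ ENNReal.ofReal m) :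
    U.card * Real.exp (-(μ ^ 2 / 2 * (π.expectedPrecisionOn μ S U).toReal)) ≤
      2 * (∑ e ∈ U, (π.law μ S).real {ω | e ∈ symmDiff (π.estimator ω) S} +
        ∑ e ∈ U, (π.law μ (S ∪ U)).real {ω | e ∈ symmDiff (π.estimator ω) (S ∪ U)}) := by
  rw [← Finset.sum_add_distrib, Finset.mul_sum, ← nsmul_eq_mul, ← Finset.sum_const]
  refine Finset.sum_le_sum fun e he => ?_
  have heS : e ∉ S := Finset.disjoint_right.1 hSU he
  have heU : e ∈ S ∪ U := Finset.mem_union_right S he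
  have hfin : π.expectedPrecisionOn μ S U ≠ ∞ := ne_top_of_le_ne_top ENNReal.ofReal_ne_top hG
  have key := π.exp_neg_le_law μ S (S ∪ U)
    (K := μ ^ 2 / 2 * (π.expectedPrecisionOn μ S U).toReal) (by positivity) (by
      rw [π.lintegral_outcomeDiv_union μ hSU, ENNReal.ofReal_mul (by positivity),
        ENNReal.ofReal_toReal hfin]) (π.measurable_estimator e)
  have h1 : {ω | e ∈ symmDiff (π.estimator ω) S} = {ω | e ∈ π.estimator ω} := by
    ext ω; simp [Finset.mem_symmDiff, heS]
  have h2 : {ω | e ∈ symmDiff (π.estimator ω) (S ∪ U)} = {ω | e ∈ π.estimator ω}ᶜ := by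
    ext ω
    simp only [Finset.mem_symmDiff, heU, Set.mem_compl_iff, Set.mem_ofPred_eq]
    tauto
  rwa [h1, h2]

/-- The trade-off between precision and error in the estimation of unions of `k` or `k + 1` members
of a family of disjoint sets of `s` coordinates. -/
theorem mul_exp_neg_le_error {s k : ℕ} (hs : ∀ i, (T i).card = s)
    (hT : Pairwise fun i j => Disjoint (T i) (T j)) (hk : k + 1 < N) {m ε : ℝ} (hm : 0 ≤ m)
    (hε : 0 ≤ ε)
    (hp : ∀ I : Finset (Fin N), I.card = k →
      π.expectedPrecision μ (I.biUnion T) ≤ ENNReal.ofReal m)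
    (he : ∀ I : Finset (Fin N), I.card = k ∨ I.card = k + 1 →
      π.expectedError μ (I.biUnion T) ≤ ENNReal.ofReal ε) :
    (N - (k + 1)) * (s * (k + 1)) * Real.exp (-(μ ^ 2 * m / (2 * (N - (k + 1))))) ≤
      2 * ε * (N + 1) := by
  have hM : (0 : ℝ) < N - (k + 1) := by
    have : ((k + 1 : ℕ) : ℝ) < N := by exact_mod_cast hk
    push_cast at this
    linarith
  -- Here `k` is one less than in the final theorem, and `N - k` sets lie outside `I`. Dividing by
  -- `N - (k + 1)` is a harmless weakening that yields the stated form; `h4` makes the same one.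
  set c := μ ^ 2 * m / (2 * (N - (k + 1) : ℝ)) with hc
  have hc0 : 0 ≤ c := by positivity
  have hmain : (N - (k + 1)) * s * Real.exp (-c) / 2 * (k + 1) ≤ ε * (N + 1) := by
    refine le_of_sum_errors_le (N := N) (k := k) (by omega)
      (fun I i => ∑ e ∈ T i, (π.law μ (I.biUnion T)).real
        {ω | e ∈ symmDiff (π.estimator ω) (I.biUnion T)})
      (fun I i => ∑ e ∈ T i, (π.law μ (I.biUnion T)).real
        {ω | e ∈ symmDiff (π.estimator ω) (I.biUnion T)})
      (fun I hI => π.sum_sum_real_le μ hT hε (he I (Or.inl hI)) _)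
      (fun J hJ => π.sum_sum_real_le μ hT hε (he J (Or.inr hJ)) _) fun I hI => ?_
    set U := I.biUnion T with hU
    have hsum := (π.sum_expectedPrecisionOn_le μ U Iᶜ T fun i _ j _ hij => hT hij).trans (hp I hI)
    have hle : ∀ i ∈ Iᶜ, π.expectedPrecisionOn μ U (T i) ≤ ENNReal.ofReal m := fun i hi =>
      (Finset.single_le_sum (f := fun i => π.expectedPrecisionOn μ U (T i))
        (fun _ _ => zero_le) hi).trans hsum
    have hreal : ∑ i ∈ Iᶜ, (π.expectedPrecisionOn μ U (T i)).toReal ≤ m := by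
      rw [← ENNReal.toReal_sum fun i hi => ne_top_of_le_ne_top ENNReal.ofReal_ne_top (hle i hi)]
      exact ENNReal.toReal_le_of_le_ofReal hm hsum
    have hcard : ((Iᶜ.card : ℕ) : ℝ) = N - k := by
      rw [Finset.card_compl, hI, Fintype.card_fin, Nat.cast_sub (by omega)]
    have hjensen := card_mul_exp_neg_le_sum Iᶜ
      (fun i => μ ^ 2 / 2 * (π.expectedPrecisionOn μ U (T i)).toReal) (c := c) (by
        rw [← Finset.mul_sum, hcard]
        calc μ ^ 2 / 2 * ∑ i ∈ Iᶜ, (π.expectedPrecisionOn μ U (T i)).toReal ≤ μ ^ 2 / 2 * m := by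
              gcongr
          _ = (N - (k + 1)) * c := by rw [hc]; field_simp
          _ ≤ (N - k) * c := by gcongr; linarith)
    rw [hcard] at hjensen
    have hpair : ∀ i ∈ Iᶜ,
        s * Real.exp (-(μ ^ 2 / 2 * (π.expectedPrecisionOn μ U (T i)).toReal)) ≤
          2 * (∑ e ∈ T i, (π.law μ U).real {ω | e ∈ symmDiff (π.estimator ω) U} +
            ∑ e ∈ T i, (π.law μ ((insert i I).biUnion T)).real
              {ω | e ∈ symmDiff (π.estimator ω) ((insert i I).biUnion T)}) := by
      intro i hi
      have hdisj : Disjoint U (T i) := by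
        rw [hU, Finset.disjoint_biUnion_left]
        intro j hj
        exact hT fun h => Finset.mem_compl.1 hi (h ▸ hj)
      have := π.card_mul_exp_neg_le μ hdisj (hle i hi)
      rwa [hs i, show U ∪ T i = (insert i I).biUnion T by
        rw [Finset.biUnion_insert, Finset.union_comm]] at this
    have hfinal := Finset.sum_le_sum hpair
    rw [← Finset.mul_sum, ← Finset.mul_sum] at hfinal
    have h4 : (N - (k + 1)) * s * Real.exp (-c) ≤ s * ((N - k) * Real.exp (-c)) := by
      rw [mul_comm (N - (k + 1) : ℝ) s, mul_assoc]
      gcongr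
      linarith
    have h5 := mul_le_mul_of_nonneg_left hjensen (Nat.cast_nonneg (α := ℝ) s)
    linarith
  linarith

end Procedure

/-- The lower bound only uses the supports built from one fixed maximum family; this places them in
the class. -/
theorem biUnion_mem_starUnions {p s N : ℕ} {T : Fin N → Finset (Edge p)}
    (hT : AreDisjointStars s T) (I : Finset (Fin N)) : I.biUnion T ∈ starUnions p s I.card := by
  refine ⟨fun j => T (I.equivFin.symm j), ⟨fun j => hT.1 _, fun i j hij => hT.2 fun h => hij ?_⟩, ?_⟩
  · exact I.equivFin.symm.injective (Subtype.ext h)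
  · ext e
    simp only [Finset.mem_biUnion, Finset.mem_univ, true_and]
    constructor
    · rintro ⟨i, hi, he⟩
      exact ⟨I.equivFin ⟨i, hi⟩, by simpa using he⟩
    · rintro ⟨j, he⟩
      exact ⟨_, (I.equivFin.symm j).2, he⟩

/-- Solving the trade-off between precision and error for the magnitude of the signal. -/
theorem sqrt_le_of_mul_exp_neg_le {N k s μ m ε : ℝ} (hk : 0 < k) (hkN : k < N) (hs : 0 < s)
    (hμ : 0 < μ) (hm : 0 < m) (hε : 0 < ε)
    (h : (N - k) * (s * k) * Real.exp (-(μ ^ 2 * m / (2 * (N - k)))) ≤ 2 * ε * (N + 1)) :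
    √(2 * (N - k) / m * (Real.log k + Real.log ((N - k) / (N + 1)) + Real.log (s / (8 * ε)))) ≤
      μ := by
  have hM : 0 < N - k := by linarith
  have hN : 0 < N + 1 := by linarith
  refine Real.sqrt_le_iff.2 ⟨hμ.le, ?_⟩
  have hlog : Real.log k + Real.log ((N - k) / (N + 1)) + Real.log (s / (8 * ε)) ≤
      μ ^ 2 * m / (2 * (N - k)) := by
    rw [← Real.log_mul (by positivity) (by positivity),
      ← Real.log_mul (by positivity) (by positivity), Real.log_le_iff_le_exp (by positivity)]
    rw [Real.exp_neg, ← div_eq_mul_inv, div_le_iff₀ (Real.exp_pos _)] at h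
    rw [show k * ((N - k) / (N + 1)) * (s / (8 * ε)) =
      (N - k) * (s * k) / (8 * ε * (N + 1)) by field_simp, div_le_iff₀ (by positivity)]
    -- The hypothesis has the constant 2 where 8 suffices; positivity of this product absorbs the
    -- difference.
    have : 0 < ε * (N + 1) * Real.exp (μ ^ 2 * m / (2 * (N - k))) := by positivity
    linarith
  calc _ ≤ 2 * (N - k) / m * (μ ^ 2 * m / (2 * (N - k))) := by gcongr
    _ = μ ^ 2 := by field_simp

end AdaptiveSensing

theorem proposition18 (p s : ℕ) (hs : 1 ≤ s) :
    (p : ℝ) * ((p : ℝ) - 1 - (s : ℝ)) / (2 * (s : ℝ)) ≤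
        (AdaptiveSensing.maxDisjointStars p s : ℝ) ∧
    ∀ k : ℕ, 1 ≤ k → k < AdaptiveSensing.maxDisjointStars p s →
    ∀ μ m ε : ℝ, 0 < μ → 0 < m → 0 < ε → ε < 1 →
    ∀ π : AdaptiveSensing.Procedure (AdaptiveSensing.Edge p),
      (∀ S ∈ AdaptiveSensing.starUnions p s k ∪ AdaptiveSensing.starUnions p s (k - 1),
        π.expectedPrecision μ S ≤ ENNReal.ofReal m) →
      (∀ S ∈ AdaptiveSensing.starUnions p s k ∪ AdaptiveSensing.starUnions p s (k - 1),
        π.expectedError μ S ≤ ENNReal.ofReal ε) →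
      √(2 * ((AdaptiveSensing.maxDisjointStars p s : ℝ) - (k : ℝ)) / m *
          (Real.log k +
            Real.log (((AdaptiveSensing.maxDisjointStars p s : ℝ) - (k : ℝ)) /
              ((AdaptiveSensing.maxDisjointStars p s : ℝ) + 1)) +
            Real.log ((s : ℝ) / (8 * ε)))) ≤ μ := by
  refine ⟨AdaptiveSensing.le_maxDisjointStars p hs, ?_⟩
  intro k hk hkN μ m ε hμ hm hε _ π hprec herr
  obtain ⟨T, hT⟩ := AdaptiveSensing.exists_maxDisjointStars p hs
  -- Removes the truncated subtraction: the smaller supports now consist of `k` stars, the larger of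
  -- `k + 1`.
  obtain ⟨k, rfl⟩ : ∃ l, k = l + 1 := ⟨k - 1, by omega⟩
  rw [Nat.add_sub_cancel] at hprec herr
  refine AdaptiveSensing.sqrt_le_of_mul_exp_neg_le (by positivity) (by exact_mod_cast hkN)
    (by exact_mod_cast hs) hμ hm hε ?_
  have h := π.mul_exp_neg_le_error μ (fun i => (hT.1 i).1) hT.2 hkN hm.le hε.le
    (fun I hI => hprec _ (Or.inr (hI ▸ AdaptiveSensing.biUnion_mem_starUnions hT I)))
    (fun I hI => herr _ (hI.elim
      (fun h => Or.inr (h ▸ AdaptiveSensing.biUnion_mem_starUnions hT I))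
      (fun h => Or.inl (h ▸ AdaptiveSensing.biUnion_mem_starUnions hT I))))
  exact_mod_cast h
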